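/- **Setting.** Let $Y_1,Y_2,\dots$ be real random variables on a probability space and $S(F,y)\in\mathbb R$ a scoring rule (the reward for quoting the predictive distribution $F$ when $y$ is realised). For $j=1,\dots,K$ let $F^{\gamma_j}_{j,t}$, $\gamma_j\in\Gamma_j\subseteq\mathbb R^{d_{\gamma_j}}$, be predictive distributions for $Y_t$ that depend on $Y_1,\dots,Y_{t-1}$, and let $F^{\theta}_{c,t}=Q_\eta(F^{\gamma_1}_{1,t},\dots,F^{\gamma_K}_{K,t})$ be their combination by a combination function $Q_\eta$, $\eta\in\mathcal E\subseteq\mathbb R^{d_\eta}$, where $\gamma=(\gamma_1,\dots,\gamma_K)$ and $\theta=(\eta,\gamma)\in\Theta=\mathcal E\times\Gamma_1\times\cdots\times\Gamma_K$. Put $$\mathcal S_n(\theta)=\tfrac1n\sum_{t=1}^n S(F^\theta_{c,t},Y_t),\quad \mathcal S_{j,n}(\gamma_j)=\tfrac1n\sum_{t=1}^n S(F^{\gamma_j}_{j,t},Y_t),$$ $$\mathcal S_0(\theta)=\lim_n\mathbb E[\mathcal S_n(\theta)],\quad \mathcal S_{j,0}(\gamma_j)=\lim_n\mathbb E[\mathcal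 S_{j,n}(\gamma_j)].$$ The one-stage estimator $\hat\theta_n$ maximises $\mathcal S_n$ over $\Theta$. The two-stage estimator is $\tilde\theta_n=(\tilde\eta_n,\tilde\gamma_n)$, where $\tilde\gamma_{j,n}$ maximises $\mathcal S_{j,n}$ over $\Gamma_j$ for each $j$ and then $\tilde\eta_n$ maximises $\eta\mapsto\mathcal S_n(\eta,\tilde\gamma_n)$ over $\mathcal E$. Let $q_n=\partial\mathcal S_n/\partial\theta$, and let $\tilde g_n(\eta,\gamma)$ be $\partial\mathcal S_n(\eta,\gamma)/\partial\eta$ stacked over $\frac1n\sum_{t=1}^n\partial S(F^{\gamma_j}_{j,t},Y_t)/\partial\gamma_j$, $j=1,\dots,K$. **Assumptions.** (A.1) $\Theta$ is compact, $\mathcal S_0$ is continuous on $\Theta$, $\sup_{\theta\in\Theta}|\mathcal S_n(\theta)-\mathcal S_0(\theta)|=o_p(1)$, and $\mathcal S_0$ has a unique maximiser $\theta^0$ over $\Theta$. (A.2) For each $j$, $\mathcal S_{j,0}$ is continuous on $\Gamma_j$, $\sup_{\gamma_j\in\Gamma_j}|\mathcal S_{j,n}(\gamma_j)-\mathcal S_{j,0}(\gamma_j)|=o_p(1)$,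 and $\mathcal S_{j,0}$ has a unique maximiser $\gamma^\star_j$ over $\Gamma_j$; with $\gamma^\star=(\gamma_1^\star,\dots,\gamma_K^\star)$, the function $\eta\mapsto\mathcal S_0(\eta,\gamma^\star)$ has a unique maximiser $\eta^\star$ over $\mathcal E$. Put $\theta^\star=(\eta^\star,\gamma^\star)$. (A.3) $\theta^0,\theta^\star\in\mathrm{Int}(\Theta)$; $\mathcal S_0$ and $\mathcal S_n$ are twice continuously differentiable on $\mathrm{Int}(\Theta)$; the gradients in $\tilde g_n$ exist on the interiors of the $\Gamma_j$, and $\partial\tilde g_n/\partial\theta'$ exists in a neighbourhood of $\theta^\star$; $\sqrt n\,q_n(\theta^0)\Rightarrow N(0,V^0)$ and $\sqrt n\,\tilde g_n(\theta^\star)\Rightarrow N(0,V^\star)$; with $M^0(\theta)=\partial^2\mathcal S_0(\theta)/\partial\theta\partial\theta'$ and some matrix function $M^\star(\theta)$, the matrices $M^0(\theta^0)$ and $M^\star(\theta^\star)$ are nonsingular, and for every nonnegative sequence $\delta_n\to0$ $$\sup_{\|\theta-\theta^0\|\le\delta_n}\Big\|\frac{\partial q_n(\theta)}{\partial\theta'}-M^0(\theta)\Big\|=o_p(1),\qquad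 \sup_{\|\theta-\theta^\star\|\le\delta_n}\Big\|\frac{\partial\tilde g_n(\theta)}{\partial\theta'}-M^\star(\theta)\Big\|=o_p(1).$$ **Theorem.** Under (A.1)–(A.3), suppose that $\partial\mathcal S_0(\eta^\star,\gamma^\star)/\partial\gamma\neq0$, and let $W^0=M^0(\theta^0)^{-1}V^0[M^0(\theta^0)^{-1}]'$ and $W^\star=M^\star(\theta^\star)^{-1}V^\star[M^\star(\theta^\star)^{-1}]'$. (One-stage) $\mathcal S_0(\hat\theta_n)-\mathcal S_0(\theta^0)=O_p(n^{-1})$ and, for $X\sim N(0,W^0)$, $$n\{\mathcal S_0(\hat\theta_n)-\mathcal S_0(\theta^0)\}\Rightarrow-\tfrac12X'\Big[-\frac{\partial^2\mathcal S_0(\theta^0)}{\partial\theta\,\partial\theta'}\Big]X.$$ (Two-stage) $\mathcal S_0(\tilde\theta_n)-\mathcal S_0(\theta^\star)=O_p(n^{-1/2})$ and, with $W^\star_{\gamma\gamma}$ the $\gamma\gamma$-block of $W^\star$, $$\sqrt n\{\mathcal S_0(\tilde\theta_n)-\mathcal S_0(\theta^\star)\}\Rightarrow N\Big(0,\Big[\frac{\partial\mathcal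 S_0(\eta^\star,\gamma^\star)}{\partial\gamma}\Big]'W^\star_{\gamma\gamma}\Big[\frac{\partial\mathcal S_0(\eta^\star,\gamma^\star)}{\partial\gamma}\Big]\Big).$$ -/

import Mathlib

open MeasureTheory ProbabilityTheory Filter Topology Matrix
open scoped Matrix.Norms.Elementwise

noncomputable section

/-- A parametric distributional forecast combination together with a scoring rule.
A predictive CDF on `ℝ` is represented by the corresponding probability measure. -/
structure ForecastCombination where
  /-- number of constituent models -/
  K : ℕ
  /-- dimension of the combination parameter -/
  dη : ℕ
  /-- dimensions of the constituent-model parameters -/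
  dγ : Fin K → ℕ
  /-- parameter space of the combination parameter -/
  E : Set (EuclideanSpace ℝ (Fin dη))
  /-- parameter spaces of the constituent models -/
  Γ : (j : Fin K) → Set (EuclideanSpace ℝ (Fin (dγ j)))
  /-- `F j t past γj`: the forecast by model `j`, with parameter `γj`, of the next observation when
  the `t` observations `past` have been seen -/
  F : (j : Fin K) → (t : ℕ) → (Fin t → ℝ) → EuclideanSpace ℝ (Fin (dγ j)) → ProbabilityMeasure ℝ
  /-- the combination function -/
  Q : EuclideanSpace ℝ (Fin dη) → (Fin K → ProbabilityMeasure ℝ) → ProbabilityMeasure ℝ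
  /-- the (positively oriented) scoring rule: `S P y` is the reward for quoting the predictive
  distribution `P` when `y` is realised -/
  S : ProbabilityMeasure ℝ → ℝ → ℝ

/-- `x` is the unique maximiser of `f` over `s`. -/
def IsUniqueArgmax {T : Type*} (f : T → ℝ) (s : Set T) (x : T) : Prop :=
  x ∈ s ∧ ∀ y ∈ s, y ≠ x → f y < f x

/-- `sup_{θ ∈ A n} ‖Z n θ‖ = o_p(1)`. The supremum exceeds a level exactly when some `θ` does; `μ` of
a set that is not measurable is its outer measure. -/
def SupIsLittleOp {Ω T B : Type*} [MeasurableSpace Ω] [Norm B] (μ : Measure Ω)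
    (A : ℕ → Set T) (Z : ℕ → Ω → T → B) : Prop :=
  ∀ ε : ℝ, 0 < ε → Tendsto (fun n => μ {ω | ∃ θ ∈ A n, ε < ‖Z n ω θ‖}) atTop (𝓝 0)

/-- `X n = O_p(a n)`. -/
def IsBigOp {Ω : Type*} [MeasurableSpace Ω] (μ : Measure Ω) (X : ℕ → Ω → ℝ) (a : ℕ → ℝ) : Prop :=
  ∀ ε : ℝ, 0 < ε → ∃ C : ℝ, ∀ᶠ n in atTop, μ {ω | C * a n < |X n ω|} ≤ ENNReal.ofReal ε

/-- `l` is the limit, as `n → ∞`, of the expectations of `X n`. -/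
def IsLimitOfExpectations {Ω : Type*} [MeasurableSpace Ω] (μ : Measure Ω) (X : ℕ → Ω → ℝ)
    (l : ℝ) : Prop :=
  (∀ᶠ n in atTop, Integrable (X n) μ) ∧ Tendsto (fun n => ∫ ω, X n ω ∂μ) atTop (𝓝 l)

/-- The Jacobian matrix `∂g(θ)/∂θ'`. -/
def jacobian {ι : Type*} [Fintype ι] [DecidableEq ι]
    (g : EuclideanSpace ℝ ι → EuclideanSpace ℝ ι) (θ : EuclideanSpace ℝ ι) : Matrix ι ι ℝ :=
  Matrix.of fun i k => (fderiv ℝ g θ (EuclideanSpace.single k 1)) i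

/-- The Hessian matrix `∂²f(θ)/∂θ∂θ'`. -/
def hessian {ι : Type*} [Fintype ι] [DecidableEq ι]
    (f : EuclideanSpace ℝ ι → ℝ) (θ : EuclideanSpace ℝ ι) : Matrix ι ι ℝ :=
  jacobian (gradient f) θ

namespace ForecastCombination

variable (c : ForecastCombination)

/-- Indices of the constituent-model coordinates. -/
abbrev IdxGamma : Type := Σ j : Fin c.K, Fin (c.dγ j)

/-- Indices of the coordinates of `θ = [η' γ']'`. -/
abbrev Idx : Type := Fin c.dη ⊕ c.IdxGamma

/-- The Euclidean space in which the full parameter `θ = [η' γ']'` lives. -/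
abbrev Param : Type := EuclideanSpace ℝ c.Idx

/-- The combination parameter `η` of `θ`. -/
def eta (θ : c.Param) : EuclideanSpace ℝ (Fin c.dη) :=
  WithLp.toLp 2 fun a => θ (Sum.inl a)

/-- The parameter `γ_j` of `θ`. -/
def gamma (θ : c.Param) (j : Fin c.K) : EuclideanSpace ℝ (Fin (c.dγ j)) :=
  WithLp.toLp 2 fun b => θ (Sum.inr ⟨j, b⟩)

/-- The stacked vector `[η' γ_1' ⋯ γ_K']'`. -/
def stack (η : EuclideanSpace ℝ (Fin c.dη))
    (γ : (j : Fin c.K) → EuclideanSpace ℝ (Fin (c.dγ j))) : c.Param :=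
  WithLp.toLp 2 (Sum.elim (fun a => η a) fun p => γ p.1 p.2)

/-- The parameter space `Θ = E × Γ_1 × ⋯ × Γ_K`. -/
def Theta : Set c.Param :=
  {θ | c.eta θ ∈ c.E ∧ ∀ j, c.gamma θ j ∈ c.Γ j}

/-- The combined predictive distribution for the observation that follows the `t` observations
`past`. -/
def Fc (t : ℕ) (past : Fin t → ℝ) (θ : c.Param) : ProbabilityMeasure ℝ :=
  c.Q (c.eta θ) fun j => c.F j t past (c.gamma θ j)

section Sample

/- The observations are numbered from `0`: `Y t` is the `(t+1)`-st one, and a sample of size `n`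
consists of `Y 0, …, Y (n - 1)`. -/

variable {Ω : Type*} (Y : ℕ → Ω → ℝ)

/-- The score of the combination at the observation `Y t`, forecast from the previous ones. -/
def score (t : ℕ) (ω : Ω) (θ : c.Param) : ℝ :=
  c.S (c.Fc t (fun i => Y i ω) θ) (Y t ω)

/-- The score of constituent model `j` at the observation `Y t`. -/
def constScore (j : Fin c.K) (t : ℕ) (ω : Ω) (γj : EuclideanSpace ℝ (Fin (c.dγ j))) : ℝ :=
  c.S (c.F j t (fun i => Y i ω) γj) (Y t ω)

/-- The in-sample average score `S_n(θ)` of the combination. -/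
def Sn (n : ℕ) (ω : Ω) (θ : c.Param) : ℝ :=
  (n : ℝ)⁻¹ * ∑ t ∈ Finset.range n, c.score Y t ω θ

/-- The in-sample average score `S_n(γ_j)` of constituent model `j`. -/
def constSn (j : Fin c.K) (n : ℕ) (ω : Ω) (γj : EuclideanSpace ℝ (Fin (c.dγ j))) : ℝ :=
  (n : ℝ)⁻¹ * ∑ t ∈ Finset.range n, c.constScore Y j t ω γj

/-- `q_n(θ) = ∂S_n(θ)/∂θ`. -/
def qn (n : ℕ) (ω : Ω) (θ : c.Param) : c.Param :=
  gradient (c.Sn Y n ω) θ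

/-- `m_{j,n}(γ_j)`, the average of the gradients of the scores of model `j`. -/
def mn (j : Fin c.K) (n : ℕ) (ω : Ω) (γj : EuclideanSpace ℝ (Fin (c.dγ j))) :
    EuclideanSpace ℝ (Fin (c.dγ j)) :=
  (n : ℝ)⁻¹ • ∑ t ∈ Finset.range n, gradient (c.constScore Y j t ω) γj

/-- The joint moment function of the two-stage estimator: `∂S_n(η, γ)/∂η` stacked over
`m_{1,n}(γ_1), …, m_{K,n}(γ_K)`. -/
def gTilde (n : ℕ) (ω : Ω) (θ : c.Param) : c.Param :=
  WithLp.toLp 2 (Sum.elim (fun a => gradient (c.Sn Y n ω) θ (Sum.inl a))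
    fun p => c.mn Y p.1 n ω (c.gamma θ p.1) p.2)

end Sample

section Conditions

variable {Ω : Type*} [MeasurableSpace Ω] (μ : Measure Ω) (Y : ℕ → Ω → ℝ)

/-- `θhat n` is a random vector that almost surely maximises `S_n` over `Θ`. -/
structure IsOneStage (θhat : ℕ → Ω → c.Param) : Prop where
  aemeasurable : ∀ n, AEMeasurable (θhat n) μ
  mem : ∀ n, ∀ᵐ ω ∂μ, θhat n ω ∈ c.Theta
  argmax : ∀ n, ∀ᵐ ω ∂μ, IsMaxOn (c.Sn Y n ω) c.Theta (θhat n ω)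

/-- `θtil n = [ηtil' γtil']'` is a random vector such that almost surely each block `γtil_j` maximises
the average score of model `j` over `Γ_j`, and `ηtil` maximises `η ↦ S_n(η, γtil)` over `E`. -/
structure IsTwoStage (θtil : ℕ → Ω → c.Param) : Prop where
  aemeasurable : ∀ n, AEMeasurable (θtil n) μ
  mem : ∀ n, ∀ᵐ ω ∂μ, θtil n ω ∈ c.Theta
  argmax_gamma : ∀ n, ∀ᵐ ω ∂μ, ∀ j,
    IsMaxOn (c.constSn Y j n ω) (c.Γ j) (c.gamma (θtil n ω) j)
  argmax_eta : ∀ n, ∀ᵐ ω ∂μ,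
    IsMaxOn (fun η => c.Sn Y n ω (c.stack η (c.gamma (θtil n ω)))) c.E (c.eta (θtil n ω))

/-- Conditions on the limiting expected average score `S0` of the combination, and on its
maximiser `θ0`. -/
structure JointConditions (S0 : c.Param → ℝ) (θ0 : c.Param) : Prop where
  compact : IsCompact c.Theta
  limit : ∀ θ ∈ c.Theta, IsLimitOfExpectations μ (fun n ω => c.Sn Y n ω θ) (S0 θ)
  continuousOn : ContinuousOn S0 c.Theta
  uniform : SupIsLittleOp μ (fun _ => c.Theta) fun n ω θ => c.Sn Y n ω θ - S0 θ
  argmax : IsUniqueArgmax S0 c.Theta θ0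

/-- Conditions on the limiting expected average scores `S0const j` of the constituent models, on
their maximisers `γstar j`, and on the maximiser `ηstar` of `η ↦ S0(η, γstar)`. -/
structure ConstituentConditions (S0 : c.Param → ℝ)
    (S0const : (j : Fin c.K) → EuclideanSpace ℝ (Fin (c.dγ j)) → ℝ)
    (ηstar : EuclideanSpace ℝ (Fin c.dη))
    (γstar : (j : Fin c.K) → EuclideanSpace ℝ (Fin (c.dγ j))) : Prop where
  limit : ∀ j, ∀ γj ∈ c.Γ j,
    IsLimitOfExpectations μ (fun n ω => c.constSn Y j n ω γj) (S0const j γj)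
  continuousOn : ∀ j, ContinuousOn (S0const j) (c.Γ j)
  uniform : ∀ j,
    SupIsLittleOp μ (fun _ => c.Γ j) fun n ω γj => c.constSn Y j n ω γj - S0const j γj
  argmax_gamma : ∀ j, IsUniqueArgmax (S0const j) (c.Γ j) (γstar j)
  argmax_eta : IsUniqueArgmax (fun η => S0 (c.stack η γstar)) c.E ηstar

/-- Smoothness, asymptotic normality and nonsingularity conditions at the limit optimizers `θ0` and
`θstar`, with asymptotic covariance matrices `V0`, `Vstar` and limit Jacobian `Mstar`. -/
structure DistributionConditions [IsProbabilityMeasure μ] (S0 : c.Param → ℝ) (θ0 θstar : c.Param)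
    (V0 Vstar : Matrix c.Idx c.Idx ℝ) (Mstar : c.Param → Matrix c.Idx c.Idx ℝ) : Prop where
  interior_zero : θ0 ∈ interior c.Theta
  interior_star : θstar ∈ interior c.Theta
  smooth_limit : ContDiffOn ℝ 2 S0 (interior c.Theta)
  smooth_sample : ∀ n, ∀ᵐ ω ∂μ, ContDiffOn ℝ 2 (c.Sn Y n ω) (interior c.Theta)
  /-- the gradients that make up `gTilde` exist -/
  diff_const : ∀ j t, ∀ᵐ ω ∂μ, DifferentiableOn ℝ (c.constScore Y j t ω) (interior (c.Γ j))
  /-- the Jacobian of `gTilde` exists near `θstar` -/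
  diff_gTilde : ∃ r : ℝ, 0 < r ∧
    ∀ n, ∀ᵐ ω ∂μ, ∀ θ ∈ Metric.ball θstar r, DifferentiableAt ℝ (c.gTilde Y n ω) θ
  posSemidef_zero : V0.PosSemidef
  posSemidef_star : Vstar.PosSemidef
  clt_zero : TendstoInDistribution (fun (n : ℕ) ω => √(n : ℝ) • c.qn Y n ω θ0) atTop id
    (fun _ => μ) (multivariateGaussian 0 V0)
  clt_star : TendstoInDistribution (fun (n : ℕ) ω => √(n : ℝ) • c.gTilde Y n ω θstar) atTop id
    (fun _ => μ) (multivariateGaussian 0 Vstar)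
  nonsingular_zero : IsUnit (hessian S0 θ0).det
  nonsingular_star : IsUnit (Mstar θstar).det
  jacobian_zero : ∀ δ : ℕ → ℝ, (∀ n, 0 ≤ δ n) → Tendsto δ atTop (𝓝 0) →
    SupIsLittleOp μ (fun n => Metric.closedBall θ0 (δ n))
      fun n ω θ => jacobian (c.qn Y n ω) θ - hessian S0 θ
  jacobian_star : ∀ δ : ℕ → ℝ, (∀ n, 0 ≤ δ n) → Tendsto δ atTop (𝓝 0) →
    SupIsLittleOp μ (fun n => Metric.closedBall θstar (δ n))
      fun n ω θ => jacobian (c.gTilde Y n ω) θ - Mstar θ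

end Conditions

/-- `∂f(θ)/∂γ`, the constituent-model block of the gradient. -/
def gradGamma (f : c.Param → ℝ) (θ : c.Param) : c.IdxGamma → ℝ :=
  fun p => gradient f θ (Sum.inr p)

end ForecastCombination

/-- The sandwich matrix `M⁻¹ V (M⁻¹)'`. -/
def sandwich {ι : Type*} [Fintype ι] [DecidableEq ι] (M V : Matrix ι ι ℝ) : Matrix ι ι ℝ :=
  M⁻¹ * V * (M⁻¹)ᵀ

end

/-! ### Convergence in outer probability, expressed by a filter. -/

section InProbability

variable {Ω : Type*} [MeasurableSpace Ω]

/-- The filter on `ℕ × Ω` of the sets whose `n`-th section has outer probability tending to one.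
Convergence along it is convergence in (outer) probability. -/
def inProbability (μ : Measure Ω) : Filter (ℕ × Ω) where
  sets := {s | Tendsto (fun n => μ {ω | (n, ω) ∉ s}) atTop (𝓝 0)}
  univ_sets := by simp
  sets_of_superset := by
    intro s t hs hst
    refine tendsto_of_tendsto_of_tendsto_of_le_of_le tendsto_const_nhds hs
      (fun _ => zero_le) fun n => measure_mono fun ω hω hs' => hω (hst hs')
  inter_sets := by
    intro s t hs ht
    have h := Tendsto.add hs ht
    rw [add_zero] at h
    refine tendsto_of_tendsto_of_tendsto_of_le_of_le tendsto_const_nhds h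
      (fun _ => zero_le) fun n => ?_
    refine (measure_mono ?_).trans (measure_union_le _ _)
    intro ω hω
    by_contra hc
    simp only [Set.mem_union, Set.mem_ofPred_eq, not_or, not_not] at hc
    exact hω hc

variable {μ : Measure Ω}

theorem eventually_inProbability_iff {P : ℕ × Ω → Prop} :
    (∀ᶠ p in inProbability μ, P p) ↔ Tendsto (fun n => μ {ω | ¬ P (n, ω)}) atTop (𝓝 0) :=
  Iff.rfl

theorem eventually_inProbability_of_ae {P : ℕ → Ω → Prop} (h : ∀ n, ∀ᵐ ω ∂μ, P n ω) :
    ∀ᶠ p in inProbability μ, P p.1 p.2 := by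
  rw [eventually_inProbability_iff]
  have : (fun n => μ {ω | ¬ P n ω}) = fun _ => 0 := funext fun n => ae_iff.1 (h n)
  simp only [this, tendsto_const_nhds]

/-- Allows arguing on an event `Q` that fails with probability at most `τ` without this tending to
zero; `Q` may depend on `τ`, as a bound or a radius typically does. -/
theorem eventually_inProbability_of_forall_le {P : ℕ → Ω → Prop}
    (h : ∀ τ : ENNReal, 0 < τ → ∃ Q : ℕ → Ω → Prop, (∀ᶠ n in atTop, μ {ω | ¬ Q n ω} ≤ τ) ∧
      ∀ᶠ p in inProbability μ, Q p.1 p.2 → P p.1 p.2) :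
    ∀ᶠ p in inProbability μ, P p.1 p.2 := by
  rw [eventually_inProbability_iff, ENNReal.tendsto_nhds_zero]
  intro τ hτ
  obtain ⟨Q, hQ, hQP⟩ := h (τ / 2) (ENNReal.half_pos hτ.ne')
  rw [eventually_inProbability_iff, ENNReal.tendsto_nhds_zero] at hQP
  filter_upwards [hQ, hQP (τ / 2) (ENNReal.half_pos hτ.ne')] with n h₁ h₂
  calc μ {ω | ¬ P n ω} ≤ μ ({ω | ¬ Q n ω} ∪ {ω | ¬ (Q n ω → P n ω)}) := by
        refine measure_mono fun ω hω => ?_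
        by_cases hq : Q n ω
        · exact Or.inr fun h => hω (h hq)
        · exact Or.inl hq
    _ ≤ τ / 2 + τ / 2 := (measure_union_le _ _).trans (add_le_add h₁ h₂)
    _ = τ := ENNReal.add_halves τ

theorem SupIsLittleOp.eventually {T B : Type*} [Norm B] {A : ℕ → Set T} {Z : ℕ → Ω → T → B}
    (h : SupIsLittleOp μ A Z) {ε : ℝ} (hε : 0 < ε) :
    ∀ᶠ p in inProbability μ, ∀ θ ∈ A p.1, ‖Z p.1 p.2 θ‖ ≤ ε := by
  rw [eventually_inProbability_iff]
  simpa only [not_forall, not_le, exists_prop] using h ε hε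

theorem tendstoInMeasure_of_tendsto_inProbability {E : Type*} [SeminormedAddCommGroup E]
    {X : ℕ → Ω → E} (h : Tendsto (fun p : ℕ × Ω => X p.1 p.2) (inProbability μ) (𝓝 0)) :
    TendstoInMeasure μ X atTop 0 := by
  rw [tendstoInMeasure_iff_norm]
  intro ε hε
  have := eventually_inProbability_iff.1 (h.norm.eventually_lt_const (by simpa using hε))
  simpa only [not_lt, Pi.zero_apply, sub_zero] using this

/-- A remainder that is eventually dominated by every positive multiple of a bounded-in-probability
sequence tends to zero in probability. -/
theorem tendsto_zero_inProbability_of_isBigOp {E : Type*} [SeminormedAddCommGroup E]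
    {R : ℕ → Ω → E} {W : ℕ → Ω → ℝ} (hW : IsBigOp μ W fun _ => 1)
    (h : ∀ ε : ℝ, 0 < ε → ∀ᶠ p in inProbability μ, ‖R p.1 p.2‖ ≤ ε * |W p.1 p.2|) :
    Tendsto (fun p : ℕ × Ω => R p.1 p.2) (inProbability μ) (𝓝 0) := by
  rw [Metric.tendsto_nhds]
  intro δ hδ
  refine eventually_inProbability_of_forall_le (P := fun n ω => dist (R n ω) 0 < δ) fun τ hτ => ?_
  obtain ⟨η, hη0, hητ⟩ := ENNReal.lt_iff_exists_nnreal_btwn.1 hτ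
  obtain ⟨C, hC⟩ := hW η (by simpa using hη0)
  refine ⟨fun n ω => |W n ω| ≤ C, ?_, ?_⟩
  · filter_upwards [hC] with n hn
    simp only [mul_one, ENNReal.ofReal_coe_nnreal] at hn
    simpa only [not_le] using hn.trans hητ.le
  -- The factor is chosen so that the remainder is at most `δ / 2` once `W` is bounded by `|C| + 1`,
  -- which is positive even if `C` is not.
  · filter_upwards [h (δ / (2 * (|C| + 1))) (by positivity)] with p hp hq
    rw [dist_zero_right]
    refine hp.trans_lt ?_
    have hC' : |W p.1 p.2| ≤ |C| + 1 := hq.trans ((le_abs_self C).trans (by linarith))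
    calc δ / (2 * (|C| + 1)) * |W p.1 p.2| ≤ δ / (2 * (|C| + 1)) * (|C| + 1) := by gcongr
      _ = δ / 2 := by field_simp
      _ < δ := half_lt_self hδ

theorem isBigOp_of_isBigOp_one {X : ℕ → Ω → ℝ} {a : ℕ → ℝ} (ha : ∀ᶠ n in atTop, 0 < a n)
    (h : IsBigOp μ (fun n ω => (a n) * X n ω) fun _ => 1) : IsBigOp μ X fun n => (a n)⁻¹ := by
  intro ε hε
  obtain ⟨C, hC⟩ := h ε hε
  refine ⟨C, ?_⟩
  filter_upwards [hC, ha] with n hn han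
  refine le_trans (measure_mono fun ω hω => ?_) hn
  simp only [Set.mem_ofPred_eq, mul_one, abs_mul, abs_of_pos han] at hω ⊢
  rwa [← div_eq_mul_inv, div_lt_iff₀ han, mul_comm] at hω

end InProbability

/-! ### Tightness and Slutsky-type transfer for convergence in distribution. -/

section InDistribution

variable {Ω Ω' : Type*} [MeasurableSpace Ω] [MeasurableSpace Ω'] {μ : Measure Ω}
  [IsProbabilityMeasure μ] {ν : Measure Ω'} [IsProbabilityMeasure ν]

/-- The limit law has arbitrarily small tails, by continuity from above; the tail sets are closed,
so the portmanteau inequality passes the bound to the sequence. -/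
theorem MeasureTheory.TendstoInDistribution.isBigOp_one {X : ℕ → Ω → ℝ} {Z : Ω' → ℝ}
    (h : TendstoInDistribution X atTop Z (fun _ => μ) ν) : IsBigOp μ X fun _ => 1 := by
  intro ε hε
  have hZ := h.aemeasurable_limit
  have := Measure.isProbabilityMeasure_map hZ (μ := ν)
  have htail : Tendsto (fun k : ℕ => (ν.map Z) {x | (k : ℝ) ≤ |x|}) atTop (𝓝 0) := by
    have h0 : (⋂ k : ℕ, {x : ℝ | (k : ℝ) ≤ |x|}) = ∅ := by
      ext x
      simp only [Set.mem_iInter, Set.mem_ofPred_eq, Set.mem_empty_iff_false, iff_false, not_forall,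
        not_le]
      exact exists_nat_gt |x|
    rw [← measure_empty (μ := ν.map Z), ← h0]
    refine tendsto_measure_iInter_atTop
      (fun k => (measurableSet_le measurable_const measurable_id.abs).nullMeasurableSet) ?_
      ⟨0, measure_ne_top _ _⟩
    intro i j hij x hx
    exact le_trans (Nat.cast_le.2 hij) (show (j : ℝ) ≤ |x| from hx)
  obtain ⟨k, hk⟩ := (htail.eventually_lt_const (ENNReal.ofReal_pos.2 hε)).exists
  refine ⟨k, ?_⟩
  have hcl : IsClosed {x : ℝ | (k : ℝ) ≤ |x|} := isClosed_le continuous_const continuous_abs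
  have hls := ProbabilityMeasure.limsup_measure_closed_le_of_tendsto h.tendsto hcl
  filter_upwards [eventually_lt_of_limsup_lt (hls.trans_lt hk)] with n hn
  refine le_trans ?_ hn.le
  simp only [ProbabilityMeasure.coe_mk]
  rw [Measure.map_apply_of_aemeasurable (h.forall_aemeasurable n) hcl.measurableSet]
  refine measure_mono fun ω hω => ?_
  simp only [mul_one, Set.mem_ofPred_eq] at hω
  exact hω.le

theorem MeasureTheory.TendstoInDistribution.isBigOp_norm {E : Type*} [NormedAddCommGroup E]
    [MeasurableSpace E] [BorelSpace E] {X : ℕ → Ω → E} {Z : Ω' → E}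
    (h : TendstoInDistribution X atTop Z (fun _ => μ) ν) :
    IsBigOp μ (fun n ω => ‖X n ω‖) fun _ => 1 :=
  (h.continuous_comp continuous_norm).isBigOp_one

/-- Convergence in distribution only depends on the law of the limit. -/
theorem MeasureTheory.TendstoInDistribution.of_map_eq {Ω'' E : Type*} [MeasurableSpace Ω'']
    {ν' : Measure Ω''} [IsProbabilityMeasure ν'] [TopologicalSpace E] [MeasurableSpace E]
    [OpensMeasurableSpace E] {X : ℕ → Ω → E} {Z : Ω' → E} {W : Ω'' → E}
    (h : TendstoInDistribution X atTop Z (fun _ => μ) ν) (hW : AEMeasurable W ν')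
    (hZW : ν.map Z = ν'.map W) : TendstoInDistribution X atTop W (fun _ => μ) ν' where
  forall_aemeasurable := h.forall_aemeasurable
  aemeasurable_limit := hW
  tendsto := by
    have : (⟨ν'.map W, Measure.isProbabilityMeasure_map hW⟩ : ProbabilityMeasure E)
        = ⟨ν.map Z, Measure.isProbabilityMeasure_map h.aemeasurable_limit⟩ :=
      Subtype.ext hZW.symm
    rw [this]
    exact h.tendsto

/-- Two sequences whose difference is negligible relative to a sequence that is bounded in
probability have the same limit in distribution. -/
theorem MeasureTheory.TendstoInDistribution.of_norm_sub_le {E : Type*}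
    [SeminormedAddCommGroup E] [SecondCountableTopology E] [MeasurableSpace E] [BorelSpace E]
    {X X' : ℕ → Ω → E} {Z : Ω' → E} {W : ℕ → Ω → ℝ}
    (h : TendstoInDistribution X atTop Z (fun _ => μ) ν) (hX' : ∀ n, AEMeasurable (X' n) μ)
    (hW : IsBigOp μ W fun _ => 1)
    (hle : ∀ ε : ℝ, 0 < ε →
      ∀ᶠ p in inProbability μ, ‖X' p.1 p.2 - X p.1 p.2‖ ≤ ε * |W p.1 p.2|) :
    TendstoInDistribution X' atTop Z (fun _ => μ) ν :=
  tendstoInDistribution_of_tendstoInMeasure_sub X' Z h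
    (tendstoInMeasure_of_tendsto_inProbability (X := X' - X)
      (tendsto_zero_inProbability_of_isBigOp (R := X' - X) hW hle)) hX'

end InDistribution

/-! ### Jacobians as linear maps, and expansions of first and second order. -/

section EuclideanCalculus

variable {ι : Type*} [Fintype ι] [DecidableEq ι]

theorem toEuclideanCLM_jacobian {g : EuclideanSpace ℝ ι → EuclideanSpace ℝ ι}
    {θ : EuclideanSpace ℝ ι} :
    toEuclideanCLM (𝕜 := ℝ) (jacobian g θ) = fderiv ℝ g θ := by
  have h : (toEuclideanCLM (𝕜 := ℝ) (jacobian g θ)).toLinearMap = (fderiv ℝ g θ).toLinearMap := by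
    refine (EuclideanSpace.basisFun ι ℝ).toBasis.ext fun k => ?_
    ext i
    simp [jacobian]
  ext x : 1
  exact LinearMap.congr_fun h x

/-- Links the entrywise norm of the Jacobian conditions to the operator norm of the mean value
inequality, by expanding in matrix units. The added `1` keeps `C` positive when there are no
indices. -/
theorem exists_norm_toEuclideanCLM_le :
    ∃ C : ℝ, 0 < C ∧ ∀ A : Matrix ι ι ℝ, ‖toEuclideanCLM (n := ι) (𝕜 := ℝ) A‖ ≤ C * ‖A‖ := by
  let T := toEuclideanCLM (n := ι) (𝕜 := ℝ)
  refine ⟨(∑ i, ∑ j, ‖T (Matrix.single i j 1)‖) + 1, by positivity, fun A => ?_⟩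
  have hA : T A = ∑ i, ∑ j, A i j • T (Matrix.single i j 1) := by
    conv_lhs => rw [matrix_eq_sum_single A]
    simp only [map_sum, ← map_smul, smul_single, smul_eq_mul, mul_one]
  change ‖T A‖ ≤ _
  rw [hA]
  calc _ ≤ ∑ i, ∑ j, ‖T (Matrix.single i j 1)‖ * ‖A‖ := by
        refine (norm_sum_le _ _).trans (Finset.sum_le_sum fun i _ => ?_)
        refine (norm_sum_le _ _).trans (Finset.sum_le_sum fun j _ => ?_)
        rw [norm_smul, mul_comm]
        gcongr
        exact norm_entry_le_entrywise_sup_norm A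
    _ = (∑ i, ∑ j, ‖T (Matrix.single i j 1)‖) * ‖A‖ := by simp only [Finset.sum_mul]
    _ ≤ _ := by gcongr; linarith

theorem gradient_differentiableAt {E : Type*} [NormedAddCommGroup E] [InnerProductSpace ℝ E]
    [CompleteSpace E] {f : E → ℝ} {θ : E} (hf : ContDiffAt ℝ 2 f θ) :
    DifferentiableAt ℝ (gradient f) θ := by
  have h : DifferentiableAt ℝ (fderiv ℝ f) θ :=
    (hf.fderiv_right (m := 1) (by norm_num)).differentiableAt (by norm_num)
  exact (InnerProductSpace.toDual ℝ E).symm.toContinuousLinearEquiv.differentiableAt.comp θ h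

theorem gradient_eq_zero_of_isLocalMax {E : Type*} [NormedAddCommGroup E] [InnerProductSpace ℝ E]
    [CompleteSpace E] {f : E → ℝ} {θ : E} (h : IsLocalMax f θ) : gradient f θ = 0 := by
  simp [gradient, h.fderiv_eq_zero]

/-- Second-order expansion at a critical point at which the gradient is differentiable. -/
theorem eventually_abs_sub_quadratic_le {E : Type*} [NormedAddCommGroup E] [InnerProductSpace ℝ E]
    [CompleteSpace E] {f : E → ℝ} {θ : E} (hf : ∀ᶠ x in 𝓝 θ, DifferentiableAt ℝ f x)
    {H : E →L[ℝ] E} (hH : HasFDerivAt (gradient f) H θ) (h0 : gradient f θ = 0)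
    {ε : ℝ} (hε : 0 < ε) :
    ∀ᶠ x in 𝓝 θ, |f x - f θ - (1 / 2) * inner ℝ (x - θ) (H (x - θ))| ≤ ε * ‖x - θ‖ ^ 2 := by
  have hlin := hH.isLittleO.def hε
  obtain ⟨r, hr, hball⟩ := Metric.eventually_nhds_iff_ball.1 (hf.and hlin)
  filter_upwards [Metric.ball_mem_nhds θ hr] with x hx
  obtain ⟨d, hd⟩ : ∃ d, d = x - θ := ⟨_, rfl⟩
  rw [← hd]
  have hmem : ∀ t ∈ Set.Icc (0 : ℝ) 1, θ + t • d ∈ Metric.ball θ r := by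
    intro t ht
    rw [mem_ball_iff_norm, add_sub_cancel_left, norm_smul, Real.norm_of_nonneg ht.1]
    exact (mul_le_of_le_one_left (norm_nonneg _) ht.2).trans_lt (hd ▸ mem_ball_iff_norm.1 hx)
  -- The gradient is differentiable only at `θ`, so the mean value inequality on the segment
  -- replaces Taylor's formula: after subtracting the quadratic term, the derivative in `t` is
  -- controlled by the first-order expansion of the gradient.
  have hderiv : ∀ t ∈ Set.Icc (0 : ℝ) 1,
      HasDerivWithinAt (fun t : ℝ => f (θ + t • d) - t ^ 2 / 2 * inner ℝ d (H d))
        (inner ℝ (gradient f (θ + t • d)) d - t * inner ℝ d (H d)) (Set.Icc 0 1) t := by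
    intro t ht
    have h1 : HasDerivAt (fun t : ℝ => θ + t • d) d t := by
      simpa using ((hasDerivAt_id t).smul_const d).const_add θ
    have h2 := ((hball _ (hmem t ht)).1.hasFDerivAt.comp_hasDerivAt t h1)
    have h3 : HasDerivAt (fun t : ℝ => t ^ 2 / 2 * inner ℝ d (H d)) (t * inner ℝ d (H d)) t := by
      have := ((hasDerivAt_pow 2 t).div_const 2).mul_const (inner ℝ d (H d))
      refine this.congr_deriv ?_
      norm_num
    rw [inner_gradient_left]
    exact (h2.sub h3).hasDerivWithinAt
  have hbound : ∀ t ∈ Set.Ico (0 : ℝ) 1,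
      ‖inner ℝ (gradient f (θ + t • d)) d - t * inner ℝ d (H d)‖ ≤ ε * ‖d‖ ^ 2 := by
    intro t ht
    have h1 := (hball _ (hmem t ⟨ht.1, ht.2.le⟩)).2
    rw [h0, sub_zero, add_sub_cancel_left, map_smul, norm_smul, Real.norm_of_nonneg ht.1] at h1
    have h2 : inner ℝ (gradient f (θ + t • d)) d - t * inner ℝ d (H d)
        = inner ℝ (gradient f (θ + t • d) - t • H d) d := by
      rw [inner_sub_left, real_inner_smul_left, real_inner_comm d (H d)]
    rw [h2]
    calc _ ≤ ‖gradient f (θ + t • d) - t • H d‖ * ‖d‖ := norm_inner_le_norm _ _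
      _ ≤ (ε * (t * ‖d‖)) * ‖d‖ := by gcongr
      _ = t * (ε * ‖d‖ ^ 2) := by ring
      _ ≤ ε * ‖d‖ ^ 2 := mul_le_of_le_one_left (by positivity) ht.2.le
  have := norm_image_sub_le_of_norm_deriv_le_segment' hderiv hbound 1 ⟨zero_le_one, le_rfl⟩
  have hx' : θ + d = x := by simp [hd]
  simp only [one_smul, zero_smul, add_zero, hx', Real.norm_eq_abs] at this
  calc _ = |f x - 1 ^ 2 / 2 * inner ℝ d (H d) - (f θ - 0 ^ 2 / 2 * inner ℝ d (H d))| := by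
        congr 1; ring
    _ ≤ _ := this
    _ = _ := by ring

/-- If the derivatives of two maps are within `C` of each other on a ball around `θ`, a first-order
expansion at `θ` of the second map carries over to the first. -/
theorem norm_sub_sub_le_of_fderiv_close {E F : Type*} [NormedAddCommGroup E] [NormedSpace ℝ E]
    [NormedAddCommGroup F] [NormedSpace ℝ F] {g ψ : E → F} {θ x : E} {r C ε : ℝ} {A : E →L[ℝ] F}
    (hg : ∀ y ∈ Metric.ball θ r, DifferentiableAt ℝ g y)
    (hψ : ∀ y ∈ Metric.ball θ r, DifferentiableAt ℝ ψ y)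
    (hC : ∀ y ∈ Metric.ball θ r, ‖fderiv ℝ g y - fderiv ℝ ψ y‖ ≤ C) (hx : x ∈ Metric.ball θ r)
    (hexp : ‖ψ x - ψ θ - A (x - θ)‖ ≤ ε * ‖x - θ‖) :
    ‖g x - g θ - A (x - θ)‖ ≤ (C + ε) * ‖x - θ‖ := by
  have hr : 0 < r := dist_nonneg.trans_lt hx
  have h := (convex_ball θ r).norm_image_sub_le_of_norm_fderiv_le (𝕜 := ℝ) (f := g - ψ) (C := C)
    (fun y hy => (hg y hy).sub (hψ y hy))
    (fun y hy => by rw [fderiv_sub (hg y hy) (hψ y hy)]; exact hC y hy)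
    (Metric.mem_ball_self hr) hx
  calc ‖g x - g θ - A (x - θ)‖
      = ‖((g - ψ) x - (g - ψ) θ) + (ψ x - ψ θ - A (x - θ))‖ := by
        congr 1; simp only [Pi.sub_apply]; abel
    _ ≤ C * ‖x - θ‖ + ε * ‖x - θ‖ := (norm_add_le _ _).trans (add_le_add h hexp)
    _ = _ := by ring

end EuclideanCalculus

/-! ### Linear images of Gaussian laws. -/

section GaussianLaws

variable {ι : Type*} [Fintype ι] [DecidableEq ι]

theorem sandwich_posSemidef {M V : Matrix ι ι ℝ} (hV : V.PosSemidef) :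
    (sandwich M V).PosSemidef := by
  have := hV.mul_mul_conjTranspose_same M⁻¹
  rwa [conjTranspose_eq_transpose_of_trivial] at this

/-- A Gaussian law is determined by its mean and covariance; the adjoint contributes the transpose,
and the two minus signs cancel in the covariance. -/
theorem multivariateGaussian_map_neg_inv {M V : Matrix ι ι ℝ} (hV : V.PosSemidef) :
    (multivariateGaussian 0 V).map (-toEuclideanCLM (𝕜 := ℝ) M⁻¹)
      = multivariateGaussian 0 (sandwich M V) := by
  apply IsGaussian.ext
  · simp only [id_eq, integral_id_multivariateGaussian]
    rw [ContinuousLinearMap.integral_id_map IsGaussian.integrable_id]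
    simp
  · ext x y
    rw [covarianceBilin_map IsGaussian.memLp_two_id, covarianceBilin_multivariateGaussian hV,
      covarianceBilin_multivariateGaussian (sandwich_posSemidef hV)]
    have hadj : ContinuousLinearMap.adjoint (-toEuclideanCLM (n := ι) (𝕜 := ℝ) M⁻¹)
        = -toEuclideanCLM (n := ι) (𝕜 := ℝ) (M⁻¹)ᵀ := by
      rw [map_neg, ← ContinuousLinearMap.star_eq_adjoint, ← map_star, star_eq_conjTranspose,
        conjTranspose_eq_transpose_of_trivial]
    simp only [hadj, _root_.neg_apply, WithLp.ofLp_neg, ofLp_toEuclideanCLM,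
      mulVec_neg, neg_dotProduct, dotProduct_neg, neg_neg, sandwich, ← mulVec_mulVec]
    rw [mulVec_transpose, ← dotProduct_mulVec]

theorem multivariateGaussian_map_inner {W : Matrix ι ι ℝ} (hW : W.PosSemidef)
    (v : EuclideanSpace ℝ ι) :
    (multivariateGaussian 0 W).map (fun x => inner ℝ v x)
      = gaussianReal 0 (Real.toNNReal (v ⬝ᵥ W *ᵥ v)) := by
  have h := IsGaussian.map_eq_gaussianReal (μ := multivariateGaussian 0 W) (innerSL ℝ v)
  rw [(innerSL ℝ v).integral_comp_id_comm IsGaussian.integrable_id,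
    integral_id_multivariateGaussian, map_zero] at h
  rw [← covarianceBilin_multivariateGaussian (μ := 0) hW,
    covarianceBilin_self IsGaussian.memLp_two_id]
  exact h

end GaussianLaws

/-! ### Linearization, asymptotic normality and the delta methods. -/

section ZEstimation

variable {Ω : Type*} [MeasurableSpace Ω] {μ : Measure Ω}

/-- A supremum over shrinking balls that is negligible for every sequence of radii tending to zero
is negligible, up to any given probability, over a fixed ball. -/
theorem exists_radius_of_forall_supIsLittleOp {E B : Type*} [PseudoMetricSpace E] [Norm B]
    {Z : ℕ → Ω → E → B} {θ : E}
    (h : ∀ δ : ℕ → ℝ, (∀ n, 0 ≤ δ n) → Tendsto δ atTop (𝓝 0) →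
      SupIsLittleOp μ (fun n => Metric.closedBall θ (δ n)) Z)
    {ε : ℝ} (hε : 0 < ε) {τ : ENNReal} (hτ : 0 < τ) :
    ∃ r : ℝ, 0 < r ∧
      ∀ᶠ n in atTop, μ {ω | ∃ x ∈ Metric.closedBall θ r, ε < ‖Z n ω x‖} ≤ τ := by
  by_contra! hc
  have hfreq : ∀ k : ℕ, ∃ᶠ n in atTop,
      τ < μ {ω | ∃ x ∈ Metric.closedBall θ (1 / ((k : ℝ) + 1)), ε < ‖Z n ω x‖} := by
    intro k
    simpa only [not_le] using! hc (1 / ((k : ℝ) + 1)) (by positivity)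
  obtain ⟨φ, hφ, hbad⟩ := extraction_forall_of_frequently hfreq
  -- If every radius fails infinitely often, radius `1 / (k + 1)` can be made to fail at `φ k` with
  -- `φ` strictly increasing. These radii, filled up with zeros, tend to zero and contradict `h`
  -- along `φ`.
  let δ : ℕ → ℝ := Function.extend φ (fun k => 1 / ((k : ℝ) + 1)) 0
  have hδφ : ∀ k, δ (φ k) = 1 / ((k : ℝ) + 1) := fun k => hφ.injective.extend_apply _ _ k
  have hδ0 : ∀ n, (¬ ∃ k, φ k = n) → δ n = 0 := fun n hn => by
    simp only [δ, Function.extend_apply' _ _ _ hn, Pi.zero_apply]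
  have hnonneg : ∀ n, 0 ≤ δ n := by
    intro n
    by_cases hn : ∃ k, φ k = n
    · obtain ⟨k, rfl⟩ := hn
      rw [hδφ]
      positivity
    · exact (hδ0 n hn).ge
  have hlim : Tendsto δ atTop (𝓝 0) := by
    rw [Metric.tendsto_atTop]
    intro η hη
    obtain ⟨k, hk⟩ := exists_nat_one_div_lt hη
    refine ⟨φ k, fun n hn => ?_⟩
    rw [Real.dist_0_eq_abs, abs_of_nonneg (hnonneg n)]
    by_cases hn' : ∃ j, φ j = n
    · obtain ⟨j, rfl⟩ := hn'
      rw [hδφ]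
      exact (Nat.one_div_le_one_div (hφ.le_iff_le.1 hn)).trans_lt hk
    · rwa [hδ0 n hn']
  have hev := ((h δ hnonneg hlim ε hε).comp hφ.tendsto_atTop).eventually_lt_const hτ
  obtain ⟨k, hk⟩ := hev.exists
  have hb := hbad k
  rw [← hδφ k] at hb
  exact lt_asymm hb hk

variable {ι : Type*} [Fintype ι] [DecidableEq ι]

/-- First-order expansion of an estimating function along a consistent sequence. The limit Jacobian
`M` is not assumed to be continuous. -/
theorem linearization_inProbability [IsProbabilityMeasure μ]
    {g : ℕ → Ω → EuclideanSpace ℝ ι → EuclideanSpace ℝ ι} {M : EuclideanSpace ℝ ι → Matrix ι ι ℝ}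
    {θ : EuclideanSpace ℝ ι} {T : ℕ → Ω → EuclideanSpace ℝ ι}
    (hdiff : ∃ r : ℝ, 0 < r ∧
      ∀ n, ∀ᵐ ω ∂μ, ∀ x ∈ Metric.ball θ r, DifferentiableAt ℝ (g n ω) x)
    (hjac : ∀ δ : ℕ → ℝ, (∀ n, 0 ≤ δ n) → Tendsto δ atTop (𝓝 0) →
      SupIsLittleOp μ (fun n => Metric.closedBall θ (δ n))
        fun n ω x => jacobian (g n ω) x - M x)
    (hT : Tendsto (fun p : ℕ × Ω => T p.1 p.2) (inProbability μ) (𝓝 θ)) {ε : ℝ} (hε : 0 < ε) :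
    ∀ᶠ p in inProbability μ,
      ‖g p.1 p.2 (T p.1 p.2) - g p.1 p.2 θ - toEuclideanCLM (𝕜 := ℝ) (M θ) (T p.1 p.2 - θ)‖
        ≤ ε * ‖T p.1 p.2 - θ‖ := by
  obtain ⟨K, hK, hKle⟩ := exists_norm_toEuclideanCLM_le (ι := ι)
  obtain ⟨r₁, hr₁, hdiff⟩ := hdiff
  have hη : 0 < ε / (4 * K) := by positivity
  refine eventually_inProbability_of_forall_le (P := fun n ω =>
    ‖g n ω (T n ω) - g n ω θ - toEuclideanCLM (𝕜 := ℝ) (M θ) (T n ω - θ)‖ ≤ ε * ‖T n ω - θ‖)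
    fun τ hτ => ?_
  -- The bound `τ` serves the probability statement; the bound `1 / 2` keeps the bad event from
  -- having full measure, so that a good path exists.
  obtain ⟨r₂, hr₂, hbad⟩ := exists_radius_of_forall_supIsLittleOp hjac hη
    (lt_min hτ (by norm_num : (0 : ENNReal) < 1 / 2))
  refine ⟨fun n ω => ∀ x ∈ Metric.closedBall θ r₂, ‖jacobian (g n ω) x - M x‖ ≤ ε / (4 * K),
    ?_, ?_⟩
  · filter_upwards [hbad] with n hn
    simpa only [not_forall, not_le, exists_prop] using hn.trans (min_le_left _ _)
  -- The frozen path `g N ω₀`. Each Jacobian is within `ε / 4` of `M` in operator norm, so two good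
  -- paths differ by `ε / 2` in derivative, and the frozen expansion at `θ` costs another `ε / 2`.
  obtain ⟨N, hN⟩ := hbad.exists
  obtain ⟨ω₀, hω₀, hω₀d⟩ : ∃ ω,
      (∀ x ∈ Metric.closedBall θ r₂, ‖jacobian (g N ω) x - M x‖ ≤ ε / (4 * K)) ∧
      ∀ x ∈ Metric.ball θ r₁, DifferentiableAt ℝ (g N ω) x := by
    by_contra! hc
    have hsub : (Set.univ : Set Ω) ⊆
        {ω | ∃ x ∈ Metric.closedBall θ r₂, ε / (4 * K) < ‖jacobian (g N ω) x - M x‖} ∪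
        {ω | ¬ ∀ x ∈ Metric.ball θ r₁, DifferentiableAt ℝ (g N ω) x} := by
      intro ω _
      by_cases h : ∀ x ∈ Metric.closedBall θ r₂, ‖jacobian (g N ω) x - M x‖ ≤ ε / (4 * K)
      · obtain ⟨x, hx, hx'⟩ := hc ω h
        exact Or.inr fun h' => hx' (h' x hx)
      · push Not at h
        exact Or.inl h
    have h1 := (measure_mono (μ := μ) hsub).trans (measure_union_le _ _)
    rw [measure_univ, ae_iff.1 (hdiff N), add_zero] at h1
    have h2 : (1 : ENNReal) ≤ 1 / 2 := h1.trans (hN.trans (min_le_right _ _))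
    exact absurd h2 (by simp)
  have hclose : ∀ {n ω} {x : EuclideanSpace ℝ ι}, ‖jacobian (g n ω) x - M x‖ ≤ ε / (4 * K) →
      ‖fderiv ℝ (g n ω) x - toEuclideanCLM (𝕜 := ℝ) (M x)‖ ≤ ε / 4 := by
    intro n ω x h
    rw [← toEuclideanCLM_jacobian, ← map_sub]
    calc _ ≤ K * ‖jacobian (g n ω) x - M x‖ := hKle _
      _ ≤ K * (ε / (4 * K)) := by gcongr
      _ = ε / 4 := by field_simp
  have hθψ : DifferentiableAt ℝ (g N ω₀) θ := hω₀d θ (Metric.mem_ball_self hr₁)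
  have hψ : ∀ᶠ x in 𝓝 θ,
      ‖g N ω₀ x - g N ω₀ θ - toEuclideanCLM (𝕜 := ℝ) (M θ) (x - θ)‖ ≤ (ε / 2) * ‖x - θ‖ := by
    have hε4 : 0 < ε / 4 := by positivity
    filter_upwards [hθψ.hasFDerivAt.isLittleO.def hε4] with x hx
    have hM := hclose (hω₀ θ (Metric.mem_closedBall_self hr₂.le))
    calc _ = ‖(g N ω₀ x - g N ω₀ θ - fderiv ℝ (g N ω₀) θ (x - θ))
            + (fderiv ℝ (g N ω₀) θ - toEuclideanCLM (𝕜 := ℝ) (M θ)) (x - θ)‖ := by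
          congr 1
          rw [_root_.sub_apply]
          abel
      _ ≤ ε / 4 * ‖x - θ‖ + ε / 4 * ‖x - θ‖ :=
          (norm_add_le _ _).trans (add_le_add hx (ContinuousLinearMap.le_of_opNorm_le _ hM _))
      _ = _ := by ring
  have hr : 0 < min r₁ r₂ := lt_min hr₁ hr₂
  filter_upwards [eventually_inProbability_of_ae hdiff, hT.eventually hψ,
    hT.eventually (Metric.ball_mem_nhds θ hr)] with p hpd hpψ hpT hpQ
  have h₁ : ∀ y ∈ Metric.ball θ (min r₁ r₂), y ∈ Metric.ball θ r₁ :=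
    Metric.ball_subset_ball (min_le_left _ _)
  have h₂ : ∀ y ∈ Metric.ball θ (min r₁ r₂), y ∈ Metric.closedBall θ r₂ := fun y hy =>
    Metric.ball_subset_closedBall (Metric.ball_subset_ball (min_le_right _ _) hy)
  have hfin := norm_sub_sub_le_of_fderiv_close (g := g p.1 p.2) (ψ := g N ω₀) (C := ε / 2)
    (fun y hy => hpd y (h₁ y hy)) (fun y hy => hω₀d y (h₁ y hy))
    (fun y hy => by
      calc _ = ‖(fderiv ℝ (g p.1 p.2) y - toEuclideanCLM (𝕜 := ℝ) (M y))
            - (fderiv ℝ (g N ω₀) y - toEuclideanCLM (𝕜 := ℝ) (M y))‖ := by congr 1; abel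
        _ ≤ ε / 4 + ε / 4 := (norm_sub_le _ _).trans
            (add_le_add (hclose (hpQ y (h₂ y hy))) (hclose (hω₀ y (h₂ y hy))))
        _ = ε / 2 := by ring)
    hpT hpψ
  rwa [add_halves] at hfin

/-- Asymptotic normality of a consistent sequence of zeros of estimating functions. -/
theorem tendstoInDistribution_of_zero [IsProbabilityMeasure μ]
    {g : ℕ → Ω → EuclideanSpace ℝ ι → EuclideanSpace ℝ ι} {A V : Matrix ι ι ℝ}
    {θ : EuclideanSpace ℝ ι} {T : ℕ → Ω → EuclideanSpace ℝ ι}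
    (hlin : ∀ ε : ℝ, 0 < ε → ∀ᶠ p in inProbability μ,
      ‖g p.1 p.2 (T p.1 p.2) - g p.1 p.2 θ - toEuclideanCLM (𝕜 := ℝ) A (T p.1 p.2 - θ)‖
        ≤ ε * ‖T p.1 p.2 - θ‖)
    (hzero : ∀ᶠ p in inProbability μ, g p.1 p.2 (T p.1 p.2) = 0)
    (hTm : ∀ n, AEMeasurable (T n) μ) (hV : V.PosSemidef) (hA : IsUnit A.det)
    (hclt : TendstoInDistribution (fun (n : ℕ) ω => √(n : ℝ) • g n ω θ) atTop id
      (fun _ => μ) (multivariateGaussian 0 V)) :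
    TendstoInDistribution (fun (n : ℕ) ω => √(n : ℝ) • (T n ω - θ)) atTop id
      (fun _ => μ) (multivariateGaussian 0 (sandwich A V)) := by
  let B := toEuclideanCLM (n := ι) (𝕜 := ℝ) A⁻¹
  have hBA : ∀ x, B (toEuclideanCLM (𝕜 := ℝ) A x) = x := by
    intro x
    have : B * toEuclideanCLM (𝕜 := ℝ) A = 1 := by
      rw [← map_mul, nonsing_inv_mul A hA, map_one]
    exact DFunLike.congr_fun this x
  have h1 : TendstoInDistribution (fun (n : ℕ) ω => √(n : ℝ) • (T n ω - θ)) atTop (-B ∘ id)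
      (fun _ => μ) (multivariateGaussian 0 V) := by
    refine (hclt.continuous_comp (g := -B) (-B).continuous).of_norm_sub_le
      (fun n => ((hTm n).sub_const θ).const_smul (√(n : ℝ))) hclt.isBigOp_norm fun ε hε => ?_
    let b := ‖B‖ + 1
    have hb : 0 < b := by positivity
    have hBle : ∀ x, ‖B x‖ ≤ b * ‖x‖ := fun x =>
      (B.le_opNorm x).trans (by gcongr; exact le_add_of_nonneg_right zero_le_one)
    -- The first bound absorbs the remainder into the left side, giving `‖D‖ ≤ 2 * b * ‖G‖`; with
    -- that, the second bound makes the remainder at most `ε * ‖G‖`.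
    have hη : 0 < min (1 / (2 * b)) (ε / (2 * b ^ 2)) := by positivity
    filter_upwards [hlin _ hη, hzero] with p hp hp0
    generalize hG : g p.1 p.2 θ = G at hp ⊢
    generalize hD : T p.1 p.2 - θ = D at hp ⊢
    rw [hp0, zero_sub, ← norm_neg, neg_sub, sub_neg_eq_add] at hp
    have hDG : ‖D + B G‖ ≤ b * (min (1 / (2 * b)) (ε / (2 * b ^ 2)) * ‖D‖) := by
      have := (hBle (toEuclideanCLM (𝕜 := ℝ) A D + G)).trans (mul_le_mul_of_nonneg_left hp hb.le)
      rwa [map_add, hBA] at this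
    have hD2 : ‖D‖ ≤ 2 * b * ‖G‖ := by
      have h2 : b * (min (1 / (2 * b)) (ε / (2 * b ^ 2)) * ‖D‖) ≤ ‖D‖ / 2 := by
        calc _ ≤ b * (1 / (2 * b) * ‖D‖) := by gcongr; exact min_le_left _ _
          _ = _ := by field_simp
      have h3 : ‖D‖ ≤ ‖D + B G‖ + ‖B G‖ := by
        simpa using norm_sub_le (D + B G) (B G)
      linarith [hBle G]
    have hfin : ‖D + B G‖ ≤ ε * ‖G‖ := by
      calc _ ≤ b * (min (1 / (2 * b)) (ε / (2 * b ^ 2)) * ‖D‖) := hDG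
        _ ≤ b * (ε / (2 * b ^ 2) * (2 * b * ‖G‖)) := by gcongr; exact min_le_right _ _
        _ = _ := by field_simp
    have heq : √(p.1 : ℝ) • D - ((-B : _ →L[ℝ] _) ∘ fun ω => √(p.1 : ℝ) • g p.1 ω θ) p.2
        = √(p.1 : ℝ) • (D + B G) := by
      simp [hG]
    rw [heq, norm_smul, abs_of_nonneg (by positivity), norm_smul]
    calc _ ≤ ‖√(p.1 : ℝ)‖ * (ε * ‖G‖) := by gcongr
      _ = _ := by ring
  refine h1.of_map_eq aemeasurable_id ?_
  rw [Measure.map_id, Function.comp_id]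
  exact multivariateGaussian_map_neg_inv hV

/-- The second-order delta method at a critical point. -/
theorem tendstoInDistribution_quadratic [IsProbabilityMeasure μ] {W : Matrix ι ι ℝ}
    {f : EuclideanSpace ℝ ι → ℝ} {H : Matrix ι ι ℝ}
    {θ : EuclideanSpace ℝ ι} {T : ℕ → Ω → EuclideanSpace ℝ ι}
    (hf : ∀ᶠ x in 𝓝 θ, DifferentiableAt ℝ f x)
    (hH : HasFDerivAt (gradient f) (toEuclideanCLM (𝕜 := ℝ) H) θ) (h0 : gradient f θ = 0)
    (hT : Tendsto (fun p : ℕ × Ω => T p.1 p.2) (inProbability μ) (𝓝 θ))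
    (hfT : ∀ n, AEMeasurable (fun ω => f (T n ω)) μ)
    (hlaw : TendstoInDistribution (fun (n : ℕ) ω => √(n : ℝ) • (T n ω - θ)) atTop id
      (fun _ => μ) (multivariateGaussian 0 W)) :
    TendstoInDistribution (fun (n : ℕ) ω => (n : ℝ) * (f (T n ω) - f θ)) atTop
      (fun x : EuclideanSpace ℝ ι => -(1 / 2 : ℝ) * ((x : ι → ℝ) ⬝ᵥ (-H) *ᵥ (x : ι → ℝ)))
      (fun _ => μ) (multivariateGaussian 0 W) := by
  have hcont : Continuous fun x : EuclideanSpace ℝ ι =>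
      (1 / 2 : ℝ) * inner ℝ x (toEuclideanCLM (𝕜 := ℝ) H x) := by fun_prop
  have hZ : (fun x : EuclideanSpace ℝ ι => -(1 / 2 : ℝ) * ((x : ι → ℝ) ⬝ᵥ (-H) *ᵥ (x : ι → ℝ)))
      = (fun x : EuclideanSpace ℝ ι =>
          (1 / 2 : ℝ) * inner ℝ x (toEuclideanCLM (𝕜 := ℝ) H x)) ∘ id := by
    funext x
    simp [inner_toEuclideanCLM, neg_mulVec]
  rw [hZ]
  -- The Taylor remainder is measured against the squared norm of the rescaled error, which is
  -- bounded in probability by continuous mapping.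
  refine (hlaw.continuous_comp hcont).of_norm_sub_le
    (fun n => ((hfT n).sub_const _).const_mul _)
    (hlaw.continuous_comp (g := fun x => ‖x‖ ^ 2) (continuous_norm.pow 2)).isBigOp_one fun ε hε => ?_
  filter_upwards [hT.eventually (eventually_abs_sub_quadratic_le hf hH h0 hε)] with p hp
  simp only [Function.comp_apply, map_smul, real_inner_smul_left, real_inner_smul_right, norm_smul,
    mul_pow, Real.norm_eq_abs, sq_abs, abs_mul, abs_pow, abs_norm]
  have hn : √(p.1 : ℝ) * √(p.1 : ℝ) = p.1 := Real.mul_self_sqrt (Nat.cast_nonneg _)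
  generalize inner ℝ (T p.1 p.2 - θ) (toEuclideanCLM (𝕜 := ℝ) H (T p.1 p.2 - θ)) = I at hp ⊢
  have heq : (p.1 : ℝ) * (f (T p.1 p.2) - f θ) - 1 / 2 * (√(p.1 : ℝ) * (√(p.1 : ℝ) * I))
      = p.1 * (f (T p.1 p.2) - f θ - 1 / 2 * I) := by
    rw [← mul_assoc (√(p.1 : ℝ)), hn]; ring
  rw [heq, abs_mul, Nat.abs_cast, sq (√(p.1 : ℝ)), hn]
  calc _ ≤ (p.1 : ℝ) * (ε * ‖T p.1 p.2 - θ‖ ^ 2) := by gcongr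
    _ = _ := by ring

/-- The delta method for a real-valued function. -/
theorem tendstoInDistribution_delta [IsProbabilityMeasure μ] {W : Matrix ι ι ℝ}
    (hW : W.PosSemidef) {f : EuclideanSpace ℝ ι → ℝ}
    {θ : EuclideanSpace ℝ ι} {T : ℕ → Ω → EuclideanSpace ℝ ι} (hf : DifferentiableAt ℝ f θ)
    (hT : Tendsto (fun p : ℕ × Ω => T p.1 p.2) (inProbability μ) (𝓝 θ))
    (hfT : ∀ n, AEMeasurable (fun ω => f (T n ω)) μ)
    (hlaw : TendstoInDistribution (fun (n : ℕ) ω => √(n : ℝ) • (T n ω - θ)) atTop id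
      (fun _ => μ) (multivariateGaussian 0 W)) :
    TendstoInDistribution (fun (n : ℕ) ω => √(n : ℝ) * (f (T n ω) - f θ)) atTop id
      (fun _ => μ) (gaussianReal 0 (Real.toNNReal
        ((gradient f θ).ofLp ⬝ᵥ W *ᵥ (gradient f θ).ofLp))) := by
  have hcont : Continuous fun x : EuclideanSpace ℝ ι => inner ℝ (gradient f θ) x := by fun_prop
  have h1 : TendstoInDistribution (fun (n : ℕ) ω => √(n : ℝ) * (f (T n ω) - f θ)) atTop
      ((fun x : EuclideanSpace ℝ ι => inner ℝ (gradient f θ) x) ∘ id)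
      (fun _ => μ) (multivariateGaussian 0 W) := by
    refine (hlaw.continuous_comp hcont).of_norm_sub_le
      (fun n => ((hfT n).sub_const _).const_mul _) hlaw.isBigOp_norm fun ε hε => ?_
    filter_upwards [hT.eventually (hf.hasFDerivAt.isLittleO.def hε)] with p hp
    rw [← inner_gradient_left] at hp
    simp only [Function.comp_apply, real_inner_smul_right, norm_smul, ← mul_sub, norm_mul,
      abs_mul, abs_norm, Real.norm_eq_abs, abs_abs] at hp ⊢
    calc _ ≤ |√(p.1 : ℝ)| * (ε * ‖T p.1 p.2 - θ‖) := by gcongr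
      _ = _ := by ring
  refine h1.of_map_eq aemeasurable_id ?_
  rw [Measure.map_id, Function.comp_id]
  exact multivariateGaussian_map_inner hW _

end ZEstimation

/-! ### Well-separated maximisers on compact sets. -/

section CompactArgmax

/-- Outside the ball `h` attains a positive minimum; half of it serves as `ε`. -/
theorem IsCompact.exists_forall_le_imp_dist_lt {X : Type*} [PseudoMetricSpace X] {K : Set X}
    (hK : IsCompact K) {h : X → ℝ} (hc : ContinuousOn h K) {x₀ : X}
    (hpos : ∀ x ∈ K, x ≠ x₀ → 0 < h x) {r : ℝ} (hr : 0 < r) :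
    ∃ ε : ℝ, 0 < ε ∧ ∀ x ∈ K, h x ≤ ε → dist x x₀ < r := by
  have hK' : IsCompact (K \ Metric.ball x₀ r) := hK.diff Metric.isOpen_ball
  rcases (K \ Metric.ball x₀ r).eq_empty_or_nonempty with he | hne
  · refine ⟨1, one_pos, fun x hx _ => ?_⟩
    exact Set.sdiff_eq_empty.1 he hx
  · obtain ⟨y, hy, hmin⟩ := hK'.exists_isMinOn hne (hc.mono Set.sdiff_subset)
    have hy0 : 0 < h y := hpos y hy.1 (by rintro rfl; exact hy.2 (Metric.mem_ball_self hr))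
    refine ⟨h y / 2, half_pos hy0, fun x hx hxε => ?_⟩
    by_contra hd
    have : h y ≤ h x := hmin ⟨hx, hd⟩
    linarith

/-- Nothing is known about `f` off `K`, so it is replaced there by zero, which changes the
composition only on a null set. -/
theorem AEMeasurable.comp_of_continuousOn {Ω X : Type*} [MeasurableSpace Ω] {μ : Measure Ω}
    [TopologicalSpace X] [MeasurableSpace X] [BorelSpace X] {f : X → ℝ} {K : Set X}
    (hK : MeasurableSet K) (hf : ContinuousOn f K) {T : Ω → X} (hT : AEMeasurable T μ)
    (hmem : ∀ᵐ ω ∂μ, T ω ∈ K) : AEMeasurable (fun ω => f (T ω)) μ := by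
  classical
  have hm : Measurable (K.piecewise f fun _ => 0) := hf.measurable_piecewise continuousOn_const hK
  refine (hm.comp_aemeasurable hT).congr ?_
  filter_upwards [hmem] with ω hω
  simp [Set.piecewise_eq_of_mem _ _ _ hω]

end CompactArgmax

/-! ### First-order conditions and consistency of both estimators. -/

namespace ForecastCombination

variable (c : ForecastCombination)

theorem stack_eta_gamma (θ : c.Param) : c.stack (c.eta θ) (c.gamma θ) = θ := by
  ext (a | p) <;> rfl

theorem gamma_stack (η : EuclideanSpace ℝ (Fin c.dη))
    (γ : (j : Fin c.K) → EuclideanSpace ℝ (Fin (c.dγ j))) : c.gamma (c.stack η γ) = γ := rfl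

theorem continuous_gamma : Continuous c.gamma := by
  refine continuous_pi fun j => (PiLp.continuous_toLp 2 _).comp (continuous_pi fun b => ?_)
  fun_prop

theorem continuous_stack : Continuous fun x : EuclideanSpace ℝ (Fin c.dη) ×
    ((j : Fin c.K) → EuclideanSpace ℝ (Fin (c.dγ j))) => c.stack x.1 x.2 := by
  refine (PiLp.continuous_toLp 2 _).comp (continuous_pi ?_)
  rintro (a | p)
  · simp only [Sum.elim_inl]
    fun_prop
  · simp only [Sum.elim_inr]
    fun_prop

theorem gamma_mem_interior {θ : c.Param} (hθ : θ ∈ interior c.Theta) (j : Fin c.K) :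
    c.gamma θ j ∈ interior (c.Γ j) := by
  -- Varying only block `j` is continuous, so an open set inside `Theta` pulls back to an open set
  -- inside `Γ j`.
  let s : EuclideanSpace ℝ (Fin (c.dγ j)) → c.Param := fun x =>
    c.stack (c.eta θ) (Function.update (c.gamma θ) j x)
  have hs : Continuous s := c.continuous_stack.comp
    (continuous_const.prodMk (continuous_const.update j continuous_id))
  refine mem_interior.2 ⟨s ⁻¹' interior c.Theta, fun x hx => ?_, isOpen_interior.preimage hs, ?_⟩
  · have := (interior_subset hx : s x ∈ c.Theta).2 j
    rwa [gamma_stack, Function.update_self] at this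
  · simpa only [s, Set.mem_preimage, Function.update_eq_self, stack_eta_gamma]

/-- The `η`-block of the gradient vanishes at an interior point that maximises over `η`. -/
theorem gradient_inl_eq_zero {f : c.Param → ℝ} {θ : c.Param} (hθ : θ ∈ interior c.Theta)
    (hf : DifferentiableAt ℝ f θ)
    (hmax : IsMaxOn (fun η => f (c.stack η (c.gamma θ))) c.E (c.eta θ)) (a : Fin c.dη) :
    gradient f θ (Sum.inl a) = 0 := by
  -- Moving along `e` leaves `γ` fixed, so the partial maximum in `η` is a local maximum on this
  -- line.
  let e : c.Param := EuclideanSpace.single (Sum.inl a) 1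
  have hline : HasDerivAt (fun t : ℝ => θ + t • e) e 0 := by
    simpa using ((hasDerivAt_id (0 : ℝ)).smul_const e).const_add θ
  have hθ0 : θ + (0 : ℝ) • e = θ := by simp
  have hderiv : HasDerivAt (fun t : ℝ => f (θ + t • e)) (fderiv ℝ f θ e) 0 := by
    have hf' : HasFDerivAt f (fderiv ℝ f θ) (θ + (0 : ℝ) • e) := by
      rw [hθ0]; exact hf.hasFDerivAt
    exact hf'.comp_hasDerivAt (0 : ℝ) hline
  have hloc : IsLocalMax (fun t : ℝ => f (θ + t • e)) 0 := by
    have hmem : ∀ᶠ t in 𝓝 (0 : ℝ), θ + t • e ∈ interior c.Theta :=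
      hline.continuousAt.eventually (isOpen_interior.mem_nhds (by simpa only [hθ0] using hθ))
    filter_upwards [hmem] with t ht
    have hγ : c.gamma (θ + t • e) = c.gamma θ := by
      funext j
      ext b
      simp [gamma, e]
    have h1 := hmax (interior_subset ht : θ + t • e ∈ c.Theta).1
    simp only [Set.mem_ofPred_eq] at h1
    rw [← hγ, stack_eta_gamma, hγ, stack_eta_gamma] at h1
    rwa [hθ0]
  have h0 := hloc.hasDerivAt_eq_zero hderiv
  rw [← inner_gradient_left, EuclideanSpace.inner_single_right] at h0
  simpa only [one_mul, conj_trivial] using h0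

variable {Ω : Type*} {Y : ℕ → Ω → ℝ}

theorem gradient_constSn {j : Fin c.K} {n : ℕ} {ω : Ω} {x : EuclideanSpace ℝ (Fin (c.dγ j))}
    (h : ∀ t, DifferentiableAt ℝ (c.constScore Y j t ω) x) :
    gradient (c.constSn Y j n ω) x = c.mn Y j n ω x := by
  have hs : DifferentiableAt ℝ (fun y => ∑ t ∈ Finset.range n, c.constScore Y j t ω y) x :=
    DifferentiableAt.fun_sum fun t _ => h t
  have hfd : fderiv ℝ (c.constSn Y j n ω) x
      = (n : ℝ)⁻¹ • ∑ t ∈ Finset.range n, fderiv ℝ (c.constScore Y j t ω) x := by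
    rw [← fderiv_fun_sum fun t _ => h t, ← fderiv_const_mul hs]
    rfl
  simp only [gradient, mn, hfd, map_smul, map_sum]

theorem gTilde_eq_zero {n : ℕ} {ω : Ω} {θ : c.Param} (hθ : θ ∈ interior c.Theta)
    (hd : DifferentiableAt ℝ (c.Sn Y n ω) θ)
    (hdc : ∀ j t, DifferentiableOn ℝ (c.constScore Y j t ω) (interior (c.Γ j)))
    (hγ : ∀ j, IsMaxOn (c.constSn Y j n ω) (c.Γ j) (c.gamma θ j))
    (hη : IsMaxOn (fun η => c.Sn Y n ω (c.stack η (c.gamma θ))) c.E (c.eta θ)) :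
    c.gTilde Y n ω θ = 0 := by
  ext (a | ⟨j, b⟩)
  · exact c.gradient_inl_eq_zero hθ hd hη a
  · have hint := c.gamma_mem_interior hθ j
    have hmn : c.mn Y j n ω (c.gamma θ j) = 0 := by
      rw [← c.gradient_constSn fun t =>
        (hdc j t).differentiableAt (isOpen_interior.mem_nhds hint)]
      exact gradient_eq_zero_of_isLocalMax ((hγ j).isLocalMax (mem_interior_iff_mem_nhds.1 hint))
    simp [gTilde, hmn]

variable [MeasurableSpace Ω] {μ : Measure Ω} {S0 : c.Param → ℝ} {θ0 : c.Param}
  {c}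

/-- The loss in `S0` at the estimator is at most twice the uniform error of `Sn`. -/
theorem JointConditions.tendsto_oneStage (h1 : c.JointConditions μ Y S0 θ0)
    {θhat : ℕ → Ω → c.Param} (hhat : c.IsOneStage μ Y θhat) :
    Tendsto (fun p : ℕ × Ω => θhat p.1 p.2) (inProbability μ) (𝓝 θ0) := by
  rw [Metric.tendsto_nhds]
  intro r hr
  obtain ⟨ε, hε, hsep⟩ := h1.compact.exists_forall_le_imp_dist_lt
    (h := fun θ => S0 θ0 - S0 θ) (continuousOn_const.sub h1.continuousOn)
    (fun θ hθ hne => sub_pos.2 (h1.argmax.2 θ hθ hne)) hr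
  filter_upwards [h1.uniform.eventually (half_pos hε), eventually_inProbability_of_ae hhat.mem,
    eventually_inProbability_of_ae hhat.argmax] with p hu hmem hmax
  refine hsep _ hmem ?_
  have h₁ := abs_le.1 (hu _ hmem)
  have h₂ := abs_le.1 (hu _ h1.argmax.1)
  have h₃ : c.Sn Y p.1 p.2 θ0 ≤ c.Sn Y p.1 p.2 (θhat p.1 p.2) := hmax h1.argmax.1
  linarith [h₁.1, h₁.2, h₂.1, h₂.2]

variable {S0const : (j : Fin c.K) → EuclideanSpace ℝ (Fin (c.dγ j)) → ℝ}
  {ηstar : EuclideanSpace ℝ (Fin c.dη)} {γstar : (j : Fin c.K) → EuclideanSpace ℝ (Fin (c.dγ j))}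

theorem ConstituentConditions.tendsto_twoStage (h1 : c.JointConditions μ Y S0 θ0)
    (h2 : c.ConstituentConditions μ Y S0 S0const ηstar γstar)
    {θtil : ℕ → Ω → c.Param} (htil : c.IsTwoStage μ Y θtil) :
    Tendsto (fun p : ℕ × Ω => θtil p.1 p.2) (inProbability μ) (𝓝 (c.stack ηstar γstar)) := by
  rw [Metric.tendsto_nhds]
  intro r hr
  have hsub : ∀ θ ∈ c.Theta, c.stack ηstar (c.gamma θ) ∈ c.Theta := fun θ hθ =>
    ⟨h2.argmax_eta.1, hθ.2⟩
  have hconst : ∀ j, ∀ x ∈ c.Γ j, 0 ≤ S0const j (γstar j) - S0const j x := by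
    intro j x hx
    by_cases hxe : x = γstar j
    · rw [hxe, sub_self]
    · exact (sub_pos.2 ((h2.argmax_gamma j).2 x hx hxe)).le
  -- One gap function handles both stages. For `γ ≠ γstar` the point `ηstar` need not be optimal, so
  -- the first difference may be negative; truncating it at zero keeps the sum positive.
  let h : c.Param → ℝ := fun θ => max 0 (S0 (c.stack ηstar (c.gamma θ)) - S0 θ)
    + ∑ j, (S0const j (γstar j) - S0const j (c.gamma θ j))
  have hcont : ContinuousOn h c.Theta := by
    refine (continuousOn_const.sup (ContinuousOn.sub ?_ h1.continuousOn)).add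
      (continuousOn_finsetSum _ fun j _ => continuousOn_const.sub ?_)
    · exact h1.continuousOn.comp (c.continuous_stack.comp
        (continuous_const.prodMk c.continuous_gamma)).continuousOn hsub
    · exact (h2.continuousOn j).comp
        ((continuous_apply j).comp c.continuous_gamma).continuousOn fun θ hθ => hθ.2 j
  have hpos : ∀ θ ∈ c.Theta, θ ≠ c.stack ηstar γstar → 0 < h θ := by
    intro θ hθ hne
    by_cases hγ : c.gamma θ = γstar
    · have hη : c.eta θ ≠ ηstar := fun hη => hne (by rw [← hη, ← hγ, stack_eta_gamma])
      have hlt := h2.argmax_eta.2 _ hθ.1 hη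
      simp only at hlt
      rw [← hγ, stack_eta_gamma] at hlt
      refine add_pos_of_pos_of_nonneg (lt_max_of_lt_right (sub_pos.2 hlt)) ?_
      exact Finset.sum_nonneg fun j _ => hconst j _ (hθ.2 j)
    · obtain ⟨j, hj⟩ := Function.ne_iff.1 hγ
      refine add_pos_of_nonneg_of_pos (le_max_left _ _) ?_
      exact Finset.sum_pos' (fun j _ => hconst j _ (hθ.2 j))
        ⟨j, Finset.mem_univ j, sub_pos.2 ((h2.argmax_gamma j).2 _ (hθ.2 j) hj)⟩
  obtain ⟨ε, hε, hsep⟩ := h1.compact.exists_forall_le_imp_dist_lt hcont hpos hr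
  -- The gap has `K + 1` terms, each at most twice the uniform error.
  have hη : 0 < ε / (2 * (c.K + 1)) := by positivity
  filter_upwards [h1.uniform.eventually hη, eventually_all.2 fun j => (h2.uniform j).eventually hη,
    eventually_inProbability_of_ae htil.mem, eventually_inProbability_of_ae htil.argmax_gamma,
    eventually_inProbability_of_ae htil.argmax_eta] with p hu huc hmem hmaxγ hmaxη
  refine hsep _ hmem ?_
  set η := ε / (2 * ((c.K : ℝ) + 1)) with hηdef
  have hfirst : max 0 (S0 (c.stack ηstar (c.gamma (θtil p.1 p.2))) - S0 (θtil p.1 p.2))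
      ≤ 2 * η := by
    refine max_le (by positivity) ?_
    have h₁ := abs_le.1 (hu _ hmem)
    have h₂ := abs_le.1 (hu _ (hsub _ hmem))
    have h₃ : c.Sn Y p.1 p.2 (c.stack ηstar (c.gamma (θtil p.1 p.2)))
        ≤ c.Sn Y p.1 p.2 (c.stack (c.eta (θtil p.1 p.2)) (c.gamma (θtil p.1 p.2))) :=
      hmaxη h2.argmax_eta.1
    rw [stack_eta_gamma] at h₃
    linarith [h₁.1, h₁.2, h₂.1, h₂.2]
  have hsecond : ∀ j, S0const j (γstar j) - S0const j (c.gamma (θtil p.1 p.2) j) ≤ 2 * η := by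
    intro j
    have h₁ := abs_le.1 (huc j _ (hmem.2 j))
    have h₂ := abs_le.1 (huc j _ (h2.argmax_gamma j).1)
    have h₃ : c.constSn Y j p.1 p.2 (γstar j) ≤ c.constSn Y j p.1 p.2 (c.gamma (θtil p.1 p.2) j) :=
      hmaxγ j (h2.argmax_gamma j).1
    linarith [h₁.1, h₁.2, h₂.1, h₂.2]
  calc h (θtil p.1 p.2) ≤ 2 * η + ∑ _j : Fin c.K, 2 * η :=
        add_le_add hfirst (Finset.sum_le_sum fun j _ => hsecond j)
    _ = ε := by
        rw [Finset.sum_const, Finset.card_univ, Fintype.card_fin, nsmul_eq_mul, hηdef]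
        field_simp
        ring

theorem dotProduct_mulVec_of_inl_eq_zero {W : Matrix c.Idx c.Idx ℝ} {f : c.Param → ℝ}
    {θ : c.Param} (h : ∀ a, gradient f θ (Sum.inl a) = 0) :
    (gradient f θ).ofLp ⬝ᵥ W *ᵥ (gradient f θ).ofLp
      = c.gradGamma f θ ⬝ᵥ W.toBlocks₂₂ *ᵥ c.gradGamma f θ := by
  have hg : (gradient f θ).ofLp = Sum.elim (0 : Fin c.dη → ℝ) (c.gradGamma f θ) := by
    funext i
    rcases i with a | p
    · exact h a
    · rfl
  rw [hg]
  conv_lhs => rw [← fromBlocks_toBlocks W]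
  rw [fromBlocks_mulVec, sumElim_dotProduct_sumElim]
  simp

end ForecastCombination

/-! ### Assembly of the two limit laws. -/

theorem theorem2 {Ω : Type*} [MeasurableSpace Ω] (μ : Measure Ω) [IsProbabilityMeasure μ]
    (c : ForecastCombination) (Y : ℕ → Ω → ℝ) (hY : ∀ t, Measurable (Y t))
    (S0 : c.Param → ℝ) (S0const : (j : Fin c.K) → EuclideanSpace ℝ (Fin (c.dγ j)) → ℝ)
    (θ0 : c.Param) (ηstar : EuclideanSpace ℝ (Fin c.dη))
    (γstar : (j : Fin c.K) → EuclideanSpace ℝ (Fin (c.dγ j)))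
    (V0 Vstar : Matrix c.Idx c.Idx ℝ) (Mstar : c.Param → Matrix c.Idx c.Idx ℝ)
    (h1 : c.JointConditions μ Y S0 θ0)
    (h2 : c.ConstituentConditions μ Y S0 S0const ηstar γstar)
    (h3 : c.DistributionConditions μ Y S0 θ0 (c.stack ηstar γstar) V0 Vstar Mstar)
    (hne : c.gradGamma S0 (c.stack ηstar γstar) ≠ 0)
    (θhat θtil : ℕ → Ω → c.Param)
    (hhat : c.IsOneStage μ Y θhat) (htil : c.IsTwoStage μ Y θtil) :
    (IsBigOp μ (fun n ω => S0 (θhat n ω) - S0 θ0) (fun n => (n : ℝ)⁻¹) ∧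
      TendstoInDistribution (fun (n : ℕ) ω => (n : ℝ) * (S0 (θhat n ω) - S0 θ0)) atTop
        (fun x : c.Param => -(1 / 2 : ℝ) * ((x : c.Idx → ℝ) ⬝ᵥ (-hessian S0 θ0) *ᵥ (x : c.Idx → ℝ)))
        (fun _ => μ) (multivariateGaussian 0 (sandwich (hessian S0 θ0) V0))) ∧
    (IsBigOp μ (fun n ω => S0 (θtil n ω) - S0 (c.stack ηstar γstar)) (fun n => (√(n : ℝ))⁻¹) ∧
      TendstoInDistribution
        (fun (n : ℕ) ω => √(n : ℝ) * (S0 (θtil n ω) - S0 (c.stack ηstar γstar))) atTop id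
        (fun _ => μ)
        (gaussianReal 0 (Real.toNNReal
          (c.gradGamma S0 (c.stack ηstar γstar) ⬝ᵥ
            (sandwich (Mstar (c.stack ηstar γstar)) Vstar).toBlocks₂₂ *ᵥ
              c.gradGamma S0 (c.stack ηstar γstar))))) := by
  have hTm : MeasurableSet c.Theta := h1.compact.isClosed.measurableSet
  have hSmooth : ∀ θ ∈ interior c.Theta, ContDiffAt ℝ 2 S0 θ := fun θ hθ =>
    h3.smooth_limit.contDiffAt (isOpen_interior.mem_nhds hθ)
  have hnpos : ∀ᶠ n : ℕ in atTop, (0 : ℝ) < n := by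
    filter_upwards [eventually_gt_atTop 0] with n hn using Nat.cast_pos.2 hn
  constructor
  · have hcons := h1.tendsto_oneStage hhat
    have hSm : ∀ n, AEMeasurable (fun ω => S0 (θhat n ω)) μ := fun n =>
      (hhat.aemeasurable n).comp_of_continuousOn hTm h1.continuousOn (hhat.mem n)
    have hdiff : ∃ r : ℝ, 0 < r ∧
        ∀ n, ∀ᵐ ω ∂μ, ∀ x ∈ Metric.ball θ0 r, DifferentiableAt ℝ (c.qn Y n ω) x := by
      obtain ⟨r, hr, hsub⟩ := Metric.mem_nhds_iff.1 (isOpen_interior.mem_nhds h3.interior_zero)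
      refine ⟨r, hr, fun n => ?_⟩
      filter_upwards [h3.smooth_sample n] with ω hω x hx
      exact gradient_differentiableAt (hω.contDiffAt (isOpen_interior.mem_nhds (hsub hx)))
    have hzero : ∀ᶠ p in inProbability μ, c.qn Y p.1 p.2 (θhat p.1 p.2) = 0 := by
      filter_upwards [hcons.eventually (isOpen_interior.mem_nhds h3.interior_zero),
        eventually_inProbability_of_ae hhat.argmax] with p hp hmax
      exact gradient_eq_zero_of_isLocalMax (hmax.isLocalMax (mem_interior_iff_mem_nhds.1 hp))
    have hlaw := tendstoInDistribution_of_zero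
      (fun ε hε => linearization_inProbability hdiff h3.jacobian_zero hcons hε)
      hzero hhat.aemeasurable h3.posSemidef_zero h3.nonsingular_zero h3.clt_zero
    have hmax : IsLocalMax S0 θ0 := by
      refine IsMaxOn.isLocalMax (s := c.Theta) (fun θ hθ => ?_)
        (mem_interior_iff_mem_nhds.1 h3.interior_zero)
      by_cases hne : θ = θ0
      · exact (congrArg S0 hne).le
      · exact (h1.argmax.2 θ hθ hne).le
    have hH : HasFDerivAt (gradient S0) (toEuclideanCLM (𝕜 := ℝ) (hessian S0 θ0)) θ0 := by
      rw [hessian, toEuclideanCLM_jacobian]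
      exact (gradient_differentiableAt (hSmooth θ0 h3.interior_zero)).hasFDerivAt
    have hev : ∀ᶠ x in 𝓝 θ0, DifferentiableAt ℝ S0 x := by
      filter_upwards [isOpen_interior.mem_nhds h3.interior_zero] with x hx
      exact (hSmooth x hx).differentiableAt (by norm_num)
    have hres := tendstoInDistribution_quadratic hev hH
      (gradient_eq_zero_of_isLocalMax hmax) hcons hSm hlaw
    exact ⟨isBigOp_of_isBigOp_one hnpos hres.isBigOp_one, hres⟩
  · have hcons := h2.tendsto_twoStage h1 htil
    have hSm : ∀ n, AEMeasurable (fun ω => S0 (θtil n ω)) μ := fun n =>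
      (htil.aemeasurable n).comp_of_continuousOn hTm h1.continuousOn (htil.mem n)
    have hzero : ∀ᶠ p in inProbability μ, c.gTilde Y p.1 p.2 (θtil p.1 p.2) = 0 := by
      filter_upwards [hcons.eventually (isOpen_interior.mem_nhds h3.interior_star),
        eventually_inProbability_of_ae htil.argmax_gamma,
        eventually_inProbability_of_ae htil.argmax_eta,
        eventually_inProbability_of_ae h3.smooth_sample,
        eventually_inProbability_of_ae fun _ : ℕ =>
          ae_all_iff.2 fun j => ae_all_iff.2 fun t => h3.diff_const j t]
        with p hp hγ hη hsm hdc
      exact c.gTilde_eq_zero hp ((hsm.contDiffAt (isOpen_interior.mem_nhds hp)).differentiableAt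
        (by norm_num)) hdc hγ hη
    have hlaw := tendstoInDistribution_of_zero
      (fun ε hε => linearization_inProbability h3.diff_gTilde h3.jacobian_star hcons hε)
      hzero htil.aemeasurable h3.posSemidef_star h3.nonsingular_star h3.clt_star
    have hd : DifferentiableAt ℝ S0 (c.stack ηstar γstar) :=
      (hSmooth _ h3.interior_star).differentiableAt (by norm_num)
    -- Optimality of `ηstar` at fixed `γstar` removes the `η` part of the linear term, leaving only
    -- the `γγ`-block of the sandwich matrix in the variance.
    have hinl : ∀ a, gradient S0 (c.stack ηstar γstar) (Sum.inl a) = 0 := by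
      refine c.gradient_inl_eq_zero h3.interior_star hd fun η hη => ?_
      by_cases hne : η = ηstar
      · exact (congrArg (fun x => S0 (c.stack x γstar)) hne).le
      · exact (h2.argmax_eta.2 η hη hne).le
    have hres := tendstoInDistribution_delta (sandwich_posSemidef h3.posSemidef_star)
      hd hcons hSm hlaw
    rw [ForecastCombination.dotProduct_mulVec_of_inl_eq_zero hinl] at hres
    refine ⟨isBigOp_of_isBigOp_one ?_ hres.isBigOp_one, hres⟩
    filter_upwards [hnpos] with n hn using Real.sqrt_pos.2 hn
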